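/- Let $\Lambda$ be a commutative local uniserial ring (its ideals are totally ordered by inclusion) of finite length $n\ge 7$, with maximal ideal generated by $t$ and residue field $k=\Lambda/\langle t\rangle$. Let $\mathcal S(\Lambda)$ be the category whose objects $M=(M_1\subseteq M_0)$ are finitely generated $\Lambda$-modules $M_0$ together with a submodule $M_1$, a morphism $M\to N$ being a $\Lambda$-linear map $f\colon M_0\to N_0$ with $f(M_1)\subseteq N_1$. Let $J_0=\Lambda/\langle t^7\rangle\oplus\Lambda/\langle t^4\rangle\oplus\Lambda/\langle t^2\rangle$, with the canonical generators $x,y,z$ of the three summands, let $J_1$ be the submodule of $J_0$ generated by $t^3x-ty$ and $ty-z$, let $I_0$ be the submodule of $J_0$ generated by $tx,y,z$, and let $I_1=tJ_1\subseteq I_0$. Let $I=(I_1\subseteq I_0)\in\mathcal S(\Lambda)$. For an object $M$ of $\mathcal S(\Lambda)$, let $\operatorname{End}(M)_I$ be the two-sided ideal of $\operatorname{End}(M)$ consisting of the endomorphisms that factor, in $\mathcal S(\Lambda)$, through a finite direct sum of copies of $I$. Then for every finite-dimensional (associative, unital) $k$-algebra $R$ there is an object $M$ of $\mathcal S(\Lambda)$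 such that $\operatorname{End}(M)/\operatorname{End}(M)_I\cong R$ as $\Lambda$-algebras, where $\Lambda$ acts on $R$ through $\Lambda\to k$. (In particular $t$ annihilates $\operatorname{End}(M)/\operatorname{End}(M)_I$, and the isomorphism is one of $k$-algebras.) -/

import Mathlib

open scoped Pointwise

universe u v

/-- An object `(M₁ ⊆ M₀)` of the submodule category `S(Λ)`: a finitely generated `Λ`-module `M₀`
(the field `carrier`) together with a submodule `M₁` (the field `sub`). -/
structure SubmodulePair (Λ : Type u) [CommRing Λ] where
  /-- the ambient module `M₀` -/
  carrier : Type u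
  [addCommGroup : AddCommGroup carrier]
  [module : Module Λ carrier]
  [finite : Module.Finite Λ carrier]
  /-- the submodule `M₁` -/
  sub : Submodule Λ carrier

namespace SubmodulePair

attribute [instance] addCommGroup module finite

variable {Λ : Type u} [CommRing Λ]

/-- `f : M₀ → N₀` is a morphism `M ⟶ N` in `S(Λ)`: a linear map with `f(M₁) ⊆ N₁`. -/
def IsHom (M N : SubmodulePair Λ) (f : M.carrier →ₗ[Λ] N.carrier) : Prop :=
  ∀ x ∈ M.sub, f x ∈ N.sub

/-- The endomorphism ring of `M` in `S(Λ)`, as a `Λ`-algebra; the product is composition. -/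
def endAlg (M : SubmodulePair Λ) : Subalgebra Λ (Module.End Λ M.carrier) where
  carrier := {f | IsHom M M f}
  mul_mem' hf hg x hx := hf _ (hg x hx)
  one_mem' _ hx := hx
  add_mem' hf hg x hx := M.sub.add_mem (hf x hx) (hg x hx)
  zero_mem' _ _ := M.sub.zero_mem
  algebraMap_mem' a _ hx := M.sub.smul_mem a hx

/-- The direct sum of `m` copies of `C` in `S(Λ)`. -/
def copies (C : SubmodulePair Λ) (m : ℕ) : SubmodulePair Λ where
  carrier := Fin m → C.carrier
  sub := Submodule.pi Set.univ fun _ => C.sub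

/-- The endomorphism `f` of `M` factors in `S(Λ)` through a finite direct sum of copies of `C`. -/
def FactorsThroughCopies (C M : SubmodulePair Λ) (f : M.carrier →ₗ[Λ] M.carrier) : Prop :=
  ∃ (m : ℕ) (g : M.carrier →ₗ[Λ] (C.copies m).carrier)
    (h : (C.copies m).carrier →ₗ[Λ] M.carrier),
    IsHom M (C.copies m) g ∧ IsHom (C.copies m) M h ∧ f = h ∘ₗ g

theorem FactorsThroughCopies.add {C M : SubmodulePair Λ} {f f' : M.carrier →ₗ[Λ] M.carrier}
    (hf : FactorsThroughCopies C M f) (hf' : FactorsThroughCopies C M f') :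
    FactorsThroughCopies C M (f + f') := by
  obtain ⟨m, g, h, hg, hh, rfl⟩ := hf
  obtain ⟨m', g', h', hg', hh', rfl⟩ := hf'
  let p : (Fin (m + m') → C.carrier) →ₗ[Λ] (Fin m → C.carrier) :=
    LinearMap.funLeft Λ C.carrier (Fin.castAdd m')
  let p' : (Fin (m + m') → C.carrier) →ₗ[Λ] (Fin m' → C.carrier) :=
    LinearMap.funLeft Λ C.carrier (Fin.natAdd m)
  let q : M.carrier →ₗ[Λ] (Fin (m + m') → C.carrier) :=
    LinearMap.pi fun i => Fin.addCases
      (fun j => (LinearMap.proj j : (Fin m → C.carrier) →ₗ[Λ] C.carrier) ∘ₗ g)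
      (fun j => (LinearMap.proj j : (Fin m' → C.carrier) →ₗ[Λ] C.carrier) ∘ₗ g') i
  have hpq : ∀ x, p (q x) = g x := by
    intro x
    funext j
    simp only [p, q, LinearMap.funLeft_apply, LinearMap.pi_apply, Fin.addCases_left]
    rfl
  have hpq' : ∀ x, p' (q x) = g' x := by
    intro x
    funext j
    simp only [p', q, LinearMap.funLeft_apply, LinearMap.pi_apply, Fin.addCases_right]
    rfl
  refine ⟨m + m', q, h ∘ₗ p + h' ∘ₗ p', ?_, ?_, ?_⟩
  · intro x hx i _
    refine Fin.addCases (fun j => ?_) (fun j => ?_) i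
    · have := hg x hx j (Set.mem_univ _)
      rw [← hpq x] at this
      exact this
    · have := hg' x hx j (Set.mem_univ _)
      rw [← hpq' x] at this
      exact this
  · intro x hx
    refine M.sub.add_mem (hh _ fun j _ => ?_) (hh' _ fun j _ => ?_)
    · exact hx (Fin.castAdd m' j) (Set.mem_univ _)
    · exact hx (Fin.natAdd m j) (Set.mem_univ _)
  · ext x
    change h (g x) + h' (g' x) = h (p (q x)) + h' (p' (q x))
    rw [hpq, hpq']

/-- `End(M)_C`: the endomorphisms of `M` factoring through a finite direct sum of copies of `C`. -/
def endIdeal (M C : SubmodulePair Λ) : Ideal M.endAlg where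
  carrier := {f | FactorsThroughCopies C M f.1}
  add_mem' hf hg := hf.add hg
  zero_mem' := ⟨0, 0, 0, fun _ _ => Submodule.zero_mem _, fun _ _ => Submodule.zero_mem _, rfl⟩
  smul_mem' := by
    rintro e f ⟨m, g, h, hg, hh, hf⟩
    refine ⟨m, g, e.1 ∘ₗ h, hg, fun x hx => e.2 _ (hh x hx), ?_⟩
    change e.1 ∘ₗ f.1 = _
    rw [hf, LinearMap.comp_assoc]

instance endIdeal_isTwoSided (M C : SubmodulePair Λ) : (endIdeal M C).IsTwoSided := by
  constructor
  rintro f e ⟨m, g, h, hg, hh, hf⟩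
  refine ⟨m, g ∘ₗ e.1, h, fun x hx => hg _ (e.2 x hx), hh, ?_⟩
  change f.1 ∘ₗ e.1 = _
  rw [hf, LinearMap.comp_assoc]

section ControlObject

variable (t : Λ)

/-- The module `J₀ = Λ/⟨t⁷⟩ ⊕ Λ/⟨t⁴⟩ ⊕ Λ/⟨t²⟩`. -/
abbrev J₀ : Type u :=
  (Λ ⧸ Ideal.span {t ^ 7}) × (Λ ⧸ Ideal.span {t ^ 4}) × (Λ ⧸ Ideal.span {t ^ 2})

/-- The generator `x` of `J₀`, annihilated by `t⁷`. -/
def genX : J₀ t := (1, 0, 0)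

/-- The generator `y` of `J₀`, annihilated by `t⁴`. -/
def genY : J₀ t := (0, 1, 0)

/-- The generator `z` of `J₀`, annihilated by `t²`. -/
def genZ : J₀ t := (0, 0, 1)

/-- The submodule `J₁` of `J₀` generated by `t³x - ty` and `ty - z`. -/
def J₁ : Submodule Λ (J₀ t) :=
  Submodule.span Λ {t ^ 3 • genX t - t • genY t, t • genY t - genZ t}

/-- The submodule `I₀` of `J₀` generated by `tx`, `y`, `z`. -/
def I₀ : Submodule Λ (J₀ t) :=
  Submodule.span Λ {t • genX t, genY t, genZ t}

/-- The submodule `I₁ = tJ₁` of `J₀`. -/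
def I₁ : Submodule Λ (J₀ t) := t • J₁ t

theorem I₁_le_I₀ : I₁ t ≤ I₀ t := by
  have hx : t • genX t ∈ I₀ t := Submodule.subset_span (by simp)
  have hy : genY t ∈ I₀ t := Submodule.subset_span (by simp)
  have hz : genZ t ∈ I₀ t := Submodule.subset_span (by simp)
  rw [I₁, J₁, Submodule.smul_span, Submodule.span_le]
  rintro _ ⟨a, (rfl | rfl), rfl⟩
  · have : t • (t ^ 3 • genX t - t • genY t) = t ^ 3 • t • genX t - t ^ 2 • genY t := by
      module
    simp only [this]
    exact Submodule.sub_mem _ (Submodule.smul_mem _ _ hx) (Submodule.smul_mem _ _ hy)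
  · exact Submodule.smul_mem _ _ (Submodule.sub_mem _ (Submodule.smul_mem _ _ hy) hz)

instance finite_I₀ : Module.Finite Λ (I₀ t) :=
  Module.Finite.span_of_finite Λ (by simp)

/-- The object `I = (I₁ ⊆ I₀)` of `S(Λ)`. -/
def controlObject : SubmodulePair Λ where
  carrier := I₀ t
  sub := (I₁ t).submoduleOf (I₀ t)

end ControlObject

end SubmodulePair

/-! Linear algebra comes first: `R` is the algebra of all endomorphisms of some `kᵐ` that commute
with an operator `T` and preserve a subspace `U` (`exists_algHom_range_eq_commute_preserve`). The
pair `(T, U)` is then stored between `I` and `J = (J₁ ⊆ J₀)`. Multiplication by `t⁶` identifies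
`J₀/I₀` with `k`, and for `ξ` in `J₁` the `x`-part of `t³ξ` together with the `y`-part of `t²ξ`
identifies `J₁/I₁` with `k²`. The object `M` (`pairOf`) satisfies `Iᵐ ⊆ M ⊆ Jᵐ`, with `M₀/I₀ᵐ = U`
and `M₁/I₁ᵐ` the graph of `T`.

An endomorphism of `M` acts on the socle vectors `t⁶x` by some `φ` on `kᵐ` (`exists_induces`).
Preservation of `M₀` makes `φ` preserve `U` (`Induces.mem`). The relations in `J₁` force the same
`φ` on the layer `t³y` (`Induces.socleY_apply`), so preservation of the graph gives `φT = Tφ`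
(`Induces.commute`). Conversely, lifting a matrix of such a `φ` to `Λ` yields an endomorphism of `M`
(`exists_isHom_induces`). Finally `φ = 0` exactly when the endomorphism factors through copies of
`I`, so the quotient is `R`. The bound `n ≥ 7` enters as `t⁶ ≠ 0`. -/

namespace SubmodulePair

/-! ### Powers of the uniformizer: divisibility, cancellation and length -/

section Uniserial

theorem length_le_add_of_exact {A M N P : Type*} [Ring A] [AddCommGroup M] [Module A M]
    [AddCommGroup N] [Module A N] [AddCommGroup P] [Module A P]
    (f : M →ₗ[A] N) (g : N →ₗ[A] P) (hg : Function.Surjective g) (hfg : Function.Exact f g) :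
    Module.length A N ≤ Module.length A M + Module.length A P := by
  have hex : Function.Exact (LinearMap.range f).subtype g := fun y => by
    rw [hfg y]
    simp
  rw [Module.length_eq_add_of_exact (LinearMap.range f).subtype g
    (Submodule.subtype_injective _) hg hex]
  gcongr
  exact Module.length_le_of_surjective f.rangeRestrict f.surjective_rangeRestrict

variable {Λ : Type u} [CommRing Λ] [IsLocalRing Λ] {t : Λ}

theorem isUnit_of_not_dvd (ht : Ideal.span {t} = IsLocalRing.maximalIdeal Λ) {a : Λ}
    (h : ¬ t ∣ a) : IsUnit a := by
  by_contra h'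
  exact h (Ideal.mem_span_singleton.1 (ht ▸ (IsLocalRing.mem_maximalIdeal a).2 h'))

theorem residue_eq_zero_iff_dvd (ht : Ideal.span {t} = IsLocalRing.maximalIdeal Λ) {a : Λ} :
    IsLocalRing.residue Λ a = 0 ↔ t ∣ a := by
  rw [IsLocalRing.residue_eq_zero_iff, ← ht, Ideal.mem_span_singleton]

/-- An element not divisible by `t ^ r` is associated to a smaller power of `t`. -/
theorem exists_associated_pow (ht : Ideal.span {t} = IsLocalRing.maximalIdeal Λ) (r : ℕ) :
    ∀ c : Λ, ¬ t ^ r ∣ c → ∃ l < r, Associated c (t ^ l) := by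
  induction r with
  | zero => intro c hc; simp at hc
  | succ r ih =>
    intro c hc
    by_cases h : t ∣ c
    · obtain ⟨d, rfl⟩ := h
      obtain ⟨l, hl, hd⟩ := ih d fun ⟨e, he⟩ => hc ⟨e, by rw [he]; ring⟩
      exact ⟨l + 1, by omega, by rw [pow_succ']; exact hd.mul_left t⟩
    · exact ⟨0, by omega, by simpa [associated_one_iff_isUnit] using isUnit_of_not_dvd ht h⟩

/-- Cancellation of powers of `t` in congruences modulo powers of `t`. -/
theorem pow_dvd_of_pow_add_dvd (ht : Ideal.span {t} = IsLocalRing.maximalIdeal Λ) {q : ℕ}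
    (hq : t ^ q ≠ 0) {i r : ℕ} (hir : i + r ≤ q + 1) {c : Λ} (h : t ^ (i + r) ∣ t ^ i * c) :
    t ^ r ∣ c := by
  by_contra hc
  obtain ⟨l, hl, u, hu⟩ := exists_associated_pow ht r c hc
  obtain ⟨d, hd⟩ := h
  obtain ⟨s, rfl⟩ := Nat.exists_eq_add_of_lt hl
  -- Up to a unit `c` is `t ^ l` with `l < r`, so `t ^ (i + l)` is a multiple of `t ^ (i + l + 1)`
  -- and therefore vanishes; but `i + l ≤ q`.
  have hunit : IsUnit (1 - t * (t ^ s * d * u)) := by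
    refine isUnit_of_not_dvd ht fun h => ?_
    have h1 : t ∣ 1 := (dvd_sub_right (Dvd.intro _ rfl)).1 (by simpa using (dvd_neg.2 h))
    have h2 : (1 : Λ) ∈ IsLocalRing.maximalIdeal Λ := ht ▸ Ideal.mem_span_singleton.2 h1
    exact (IsLocalRing.maximalIdeal Λ).one_notMem h2
  have hzero : t ^ (i + l) * (1 - t * (t ^ s * d * u)) = 0 := by
    have : t ^ i * c * u = t ^ (i + (l + s + 1)) * d * u := by rw [hd]
    rw [mul_assoc, hu] at this
    calc _ = t ^ i * t ^ l - t ^ (i + (l + s + 1)) * d * u := by ring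
      _ = 0 := by rw [this, sub_self]
  have hil : t ^ (i + l) = 0 := by
    rwa [hunit.mul_left_eq_zero] at hzero
  exact hq (pow_eq_zero_of_le (by omega) hil)

/-- Multiplication by `t ^ j`, as a map from the residue field to `Λ ⧸ ⟨t ^ l⟩`. -/
def socleMap (ht : Ideal.span {t} = IsLocalRing.maximalIdeal Λ) (j l : ℕ) (hl : l ≤ j + 1) :
    IsLocalRing.ResidueField Λ →ₗ[Λ] Λ ⧸ Ideal.span {t ^ l} :=
  (IsLocalRing.maximalIdeal Λ).liftQ
    ((Ideal.span {t ^ l}).mkQ ∘ₗ LinearMap.mulLeft Λ (t ^ j)) <| by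
      rw [← ht, Ideal.span_le, Set.singleton_subset_iff]
      refine (Submodule.Quotient.mk_eq_zero _).2 (Ideal.mem_span_singleton.2 ?_)
      exact (pow_dvd_pow t hl).trans (dvd_of_eq (pow_succ t j))

theorem socleMap_residue (ht : Ideal.span {t} = IsLocalRing.maximalIdeal Λ) (j l : ℕ)
    (hl : l ≤ j + 1) (a : Λ) :
    socleMap ht j l hl (IsLocalRing.residue Λ a) = Ideal.Quotient.mk _ (t ^ j * a) :=
  rfl

theorem socleMap_injective (ht : Ideal.span {t} = IsLocalRing.maximalIdeal Λ) {q : ℕ}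
    (hq : t ^ q ≠ 0) {j l : ℕ} (hl : l = j + 1) (hj : j ≤ q) :
    Function.Injective (socleMap ht j l hl.le) := by
  subst hl
  refine (injective_iff_map_eq_zero _).2 fun a ha => ?_
  obtain ⟨a, rfl⟩ := IsLocalRing.residue_surjective a
  rw [socleMap_residue, Ideal.Quotient.eq_zero_iff_mem, Ideal.mem_span_singleton] at ha
  rw [residue_eq_zero_iff_dvd ht]
  simpa using pow_dvd_of_pow_add_dvd ht hq (by omega) ha

/-- Multiplication by `t ^ i` maps the residue field onto `⟨t ^ i⟩/⟨t ^ (i + 1)⟩`, so each power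
adds at most one to the length. This upper bound is all that is needed to see that high powers of
`t` survive in a ring of large length. -/
theorem length_quotient_span_pow_le (ht : Ideal.span {t} = IsLocalRing.maximalIdeal Λ) (i : ℕ) :
    Module.length Λ (Λ ⧸ Ideal.span {t ^ i}) ≤ i := by
  induction i with
  | zero =>
    have : Subsingleton (Λ ⧸ Ideal.span {t ^ 0}) :=
      Ideal.Quotient.subsingleton_iff.2 (by simp)
    simp
  | succ i ih =>
    have hsimple : IsSimpleModule Λ (IsLocalRing.ResidueField Λ) :=
      isSimpleModule_iff_isCoatom.2 (IsLocalRing.maximalIdeal.isMaximal Λ).out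
    have hle : Ideal.span {t ^ (i + 1)} ≤ Ideal.span {t ^ i} :=
      Ideal.span_singleton_le_span_singleton.2 (pow_dvd_pow t i.le_succ)
    refine (length_le_add_of_exact (socleMap ht i (i + 1) le_rfl) (Submodule.factor hle)
      (Submodule.factor_surjective hle) fun y => ?_).trans ?_
    · obtain ⟨y, rfl⟩ := Submodule.Quotient.mk_surjective _ y
      rw [← Submodule.mkQ_apply, Submodule.factor_mk, Submodule.mkQ_apply,
        Submodule.Quotient.mk_eq_zero, Ideal.mem_span_singleton]
      constructor
      · rintro ⟨c, rfl⟩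
        exact ⟨IsLocalRing.residue Λ c, rfl⟩
      · rintro ⟨c, hc⟩
        obtain ⟨c, rfl⟩ := IsLocalRing.residue_surjective c
        have := Ideal.mem_span_singleton.1 ((Submodule.Quotient.eq _).1 hc.symm)
        have h2 : t ^ i ∣ y - t ^ i * c := (pow_dvd_pow t i.le_succ).trans this
        exact (dvd_sub_left (Dvd.intro _ rfl)).1 h2
    · rw [Module.length_eq_one, add_comm]
      push_cast
      gcongr

theorem pow_ne_zero_of_lt_length (ht : Ideal.span {t} = IsLocalRing.maximalIdeal Λ) {q : ℕ}
    (hq : (q : ℕ∞) < Module.length Λ Λ) : t ^ q ≠ 0 := by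
  intro h
  have hbot : Ideal.span {t ^ q} = ⊥ := by rw [h]; simp
  have := length_quotient_span_pow_le ht q
  rw [hbot, (Submodule.quotEquivOfEqBot (⊥ : Ideal Λ) rfl).length_eq] at this
  exact absurd hq (not_lt.2 this)

end Uniserial

end SubmodulePair

/-! ### Realizing an algebra by one operator and one subspace -/

section LinearAlgebra

variable {K : Type u} [Field K] {R : Type v} [Ring R] [Algebra K R]

/-- The nilpotent shift on `Rᴺ`. -/
def shiftMap (K : Type u) [Field K] (R : Type v) [Ring R] [Algebra K R] (N : ℕ) :
    Module.End K (Fin N → R) where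
  toFun v i := if h : (i : ℕ) = 0 then 0 else v ⟨i - 1, by omega⟩
  map_add' v w := by ext i; by_cases h : (i : ℕ) = 0 <;> simp [h]
  map_smul' c v := by ext i; by_cases h : (i : ℕ) = 0 <;> simp [h]

theorem shiftMap_zero {N : ℕ} (v : Fin N → R) {i : ℕ} (hi : i < N) (h : i = 0) :
    shiftMap K R N v ⟨i, hi⟩ = 0 := by
  simp [shiftMap, h]

theorem shiftMap_succ {N : ℕ} (v : Fin N → R) {i : ℕ} (hi : i + 1 < N) :
    shiftMap K R N v ⟨i + 1, hi⟩ = v ⟨i, by omega⟩ := by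
  simp [shiftMap]

/-- The subspace of `Rᴺ` of all `v` with `v (j + 2) = v 1 * b j` for `j < s` and `v i = 0` for
`i > s + 2`. -/
def markedSubspace (K : Type u) [Field K] {R : Type v} [Ring R] [Algebra K R] (N : ℕ) {s : ℕ}
    (b : Fin s → R) : Submodule K (Fin N → R) where
  carrier := {v | (∀ (i j : Fin N) (l : Fin s), (i : ℕ) = 1 → (j : ℕ) = l + 2 → v j = v i * b l) ∧
    ∀ i : Fin N, s + 2 < (i : ℕ) → v i = 0}
  add_mem' hv hw := ⟨fun i j l hi hj => by simp [hv.1 i j l hi hj, hw.1 i j l hi hj, add_mul],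
    fun i hi => by simp [hv.2 i hi, hw.2 i hi]⟩
  zero_mem' := ⟨by simp, by simp⟩
  smul_mem' c v hv := ⟨fun i j l hi hj => by simp [hv.1 i j l hi hj],
    fun i hi => by simp [hv.2 i hi]⟩

theorem shiftMap_pow_apply {N : ℕ} (v : Fin N → R) (c i : ℕ) (hi : i < N) :
    (shiftMap K R N ^ c) v ⟨i, hi⟩ = if h : c ≤ i then v ⟨i - c, by omega⟩ else 0 := by
  induction c generalizing i with
  | zero => simp
  | succ c ih =>
    rw [pow_succ', Module.End.mul_apply]
    rcases i with _ | i
    · rw [shiftMap_zero _ _ rfl]; simp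
    · rw [shiftMap_succ, ih]
      simp

theorem shiftMap_pow_single {N : ℕ} (hN : 0 < N) (c : ℕ) (hc : c < N) (r : R) :
    (shiftMap K R N ^ c) (Pi.single ⟨0, hN⟩ r) = Pi.single ⟨c, hc⟩ r := by
  ext ⟨i, hi⟩
  rw [shiftMap_pow_apply]
  by_cases h : c ≤ i
  · rw [dif_pos h]
    by_cases h' : i = c
    · subst h'; simp
    · rw [Pi.single_eq_of_ne, Pi.single_eq_of_ne]
      · simpa using h'
      · simp; omega
  · rw [dif_neg h, Pi.single_eq_of_ne]
    simp; omega

/-- An endomorphism of `Rᴺ` that commutes with the shift and preserves the marked subspace is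
given by left multiplication by an element of `R`. -/
theorem exists_eq_mul_of_commute_shiftMap {s N : ℕ} (hN : N = 2 * s + 5) (b : Fin s → R)
    (hb : Submodule.span K (Set.range b) = ⊤) (f : Module.End K (Fin N → R))
    (hf : Commute f (shiftMap K R N))
    (hU : ∀ v ∈ markedSubspace K N b, f v ∈ markedSubspace K N b) :
    ∃ r : R, ∀ v i, f v i = r * v i := by
  have hN0 : 0 < N := by omega
  set F : R → Fin N → R := fun r => f (Pi.single ⟨0, hN0⟩ r) with hF
  have hsingle : ∀ (c : ℕ) (hc : c < N) (r : R) (i : ℕ) (hi : i < N),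
      f (Pi.single ⟨c, hc⟩ r) ⟨i, hi⟩ = if h : c ≤ i then F r ⟨i - c, by omega⟩ else 0 := by
    intro c hc r i hi
    rw [← shiftMap_pow_single (K := K) hN0 c hc r, ← Module.End.mul_apply,
      (hf.pow_right c).eq, Module.End.mul_apply, shiftMap_pow_apply]
  -- Slots `0` and `s + 2` are the two free coordinates of the marked subspace.
  have hmem : ∀ (c : ℕ) (hc : c < N) (r : R), c = 0 ∨ c = s + 2 →
      (Pi.single ⟨c, hc⟩ r : Fin N → R) ∈ markedSubspace K N b := by
    intro c hc r h
    refine ⟨fun i j l hi hj => ?_, fun i hi => ?_⟩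
    · rw [Pi.single_eq_of_ne, Pi.single_eq_of_ne, zero_mul]
      · rintro rfl; simp at hi; omega
      · rintro rfl; simp at hj; omega
    · rw [Pi.single_eq_of_ne]
      rintro rfl; simp at hi; omega
  have hzero : ∀ (r : R) (i : ℕ) (hi : i < N), i ≠ 0 → F r ⟨i, hi⟩ = 0 := by
    intro r i hi h0
    -- Commuting with the shift makes `f` lower triangular Toeplitz with first column `F`. Its
    -- entries beyond `s + 2` vanish because slot `0` is free. The entries at `1, …, s + 2` reappear
    -- in column `s + 2` at rows `s + 3, …, 2s + 4`, where they must vanish too; hence `N = 2s + 5`.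
    by_cases h : s + 2 < i
    · exact (hU _ (hmem 0 hN0 r (Or.inl rfl))).2 ⟨i, hi⟩ h
    · have := (hU _ (hmem (s + 2) (by omega) r (Or.inr rfl))).2 ⟨s + 2 + i, by omega⟩
        (by simp; omega)
      rw [hsingle, dif_pos (by omega)] at this
      simpa using this
  have hdiag : ∀ v i, f v i = F (v i) ⟨0, hN0⟩ := by
    rintro v ⟨i, hi⟩
    have hv : v = ∑ c, Pi.single c (v c) := (Finset.univ_sum_single v).symm
    conv_lhs => rw [hv, map_sum, Finset.sum_apply]
    rw [Finset.sum_eq_single ⟨i, hi⟩]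
    · rw [hsingle, dif_pos le_rfl]; simp
    · rintro ⟨c, hc⟩ - hci
      rw [hsingle]
      split_ifs with h
      · refine hzero _ _ _ fun h' => hci ?_
        ext; simp; omega
      · rfl
    · simp
  let G : R →ₗ[K] R := (LinearMap.proj ⟨0, hN0⟩) ∘ₗ f ∘ₗ LinearMap.single K (fun _ => R) ⟨0, hN0⟩
  have hG : ∀ v i, f v i = G (v i) := hdiag
  have hmul : ∀ (r : R) (l : Fin s), G (r * b l) = G r * b l := by
    intro r l
    -- The marked vector with `r` in slot `1` and zeros in the free slots: its image ties `G (r * b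
    -- l)` to `G r`.
    let w : Fin N → R := fun i =>
      if (i : ℕ) = 1 then r else if h : 2 ≤ (i : ℕ) ∧ (i : ℕ) < s + 2 then
        r * b ⟨i - 2, by omega⟩ else 0
    have hw : w ∈ markedSubspace K N b := by
      refine ⟨fun i j l hi hj => ?_, fun i hi => ?_⟩
      · have h2 : 2 ≤ (j : ℕ) ∧ (j : ℕ) < s + 2 := by omega
        have h1 : (j : ℕ) ≠ 1 := by omega
        simp only [w, hi, if_true, h1, if_false, dif_pos h2]
        congr 2
        ext; simp; omega
      · have h2 : ¬ (2 ≤ (i : ℕ) ∧ (i : ℕ) < s + 2) := by omega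
        have h1 : (i : ℕ) ≠ 1 := by omega
        simp only [w, h1, if_false, dif_neg h2]
    have hl := hw.1 ⟨1, by omega⟩ ⟨l + 2, by omega⟩ l rfl rfl
    have h := (hU w hw).1 ⟨1, by omega⟩ ⟨l + 2, by omega⟩ l rfl rfl
    rw [hG, hG, hl] at h
    simpa [w] using h
  have hmulAll : ∀ r x : R, G (r * x) = G r * x := by
    intro r x
    have hx : x ∈ Submodule.span K (Set.range b) := hb ▸ Submodule.mem_top
    induction hx using Submodule.span_induction with
    | mem x hx => obtain ⟨l, rfl⟩ := hx; exact hmul r l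
    | zero => simp
    | add x y _ _ hx hy => rw [mul_add, map_add, hx, hy, mul_add]
    | smul c x _ hx => rw [mul_smul_comm, map_smul, hx, mul_smul_comm]
  exact ⟨G 1, fun v i => by rw [hG, ← hmulAll, one_mul]⟩

/-- Every finite-dimensional algebra is the algebra of endomorphisms of a finite-dimensional vector
space that commute with a given endomorphism and preserve a given subspace. -/
theorem exists_algHom_range_eq_commute_preserve (K : Type u) [Field K] (R : Type v) [Ring R]
    [Algebra K R] [FiniteDimensional K R] :
    ∃ (m : ℕ) (T : Module.End K (Fin m → K)) (U : Submodule K (Fin m → K))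
      (ρ : R →ₐ[K] Module.End K (Fin m → K)), Function.Injective ρ ∧
      ∀ φ : Module.End K (Fin m → K),
        φ ∈ Set.range ρ ↔ Commute φ T ∧ ∀ v ∈ U, φ v ∈ U := by
  let b := Module.finBasis K R
  obtain ⟨N, hN⟩ : ∃ N, N = 2 * Module.finrank K R + 5 := ⟨_, rfl⟩
  let e : (Fin N → R) ≃ₗ[K] (Fin _ → K) := (Module.finBasis K (Fin N → R)).equivFun
  let ρ₀ : R →ₐ[K] Module.End K (Fin N → R) :=
    AlgHom.ofLinearMap
      { toFun := fun r => LinearMap.pi fun i => LinearMap.mulLeft K r ∘ₗ LinearMap.proj i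
        map_add' := fun r r' => by ext; simp [add_mul]
        map_smul' := fun c r => by ext; simp }
      (by ext; simp) (fun r r' => by ext; simp)
  have hρ₀ : ∀ r v i, ρ₀ r v i = r * v i := fun _ _ _ => rfl
  let E := LinearEquiv.conjAlgEquiv K e
  have hE : ∀ φ v, E φ (e v) = e (φ v) := fun φ v => by simp [E]
  refine ⟨_, E (shiftMap K R N), (markedSubspace K N b).map e.toLinearMap,
    E.toAlgHom.comp ρ₀, ?_, fun φ => ?_⟩
  · refine E.injective.comp fun r r' h => ?_
    have := congrFun (LinearMap.congr_fun h fun _ => 1) ⟨0, by omega⟩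
    simpa [hρ₀] using this
  · obtain ⟨φ, rfl⟩ := E.surjective φ
    have hrange : E φ ∈ Set.range (E.toAlgHom.comp ρ₀) ↔ φ ∈ Set.range ρ₀ := by
      simp
    have hcomm : Commute (E φ) (E (shiftMap K R N)) ↔ Commute φ (shiftMap K R N) := by
      rw [Commute, SemiconjBy, ← map_mul, ← map_mul, E.injective.eq_iff]; rfl
    have hU : (∀ v ∈ (markedSubspace K N b).map e.toLinearMap,
        E φ v ∈ (markedSubspace K N b).map e.toLinearMap) ↔
        ∀ v ∈ markedSubspace K N b, φ v ∈ markedSubspace K N b := by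
      constructor
      · intro h v hv
        obtain ⟨w, hw, hwv⟩ := h (e v) ⟨v, hv, rfl⟩
        rw [hE] at hwv
        rwa [← e.injective hwv]
      · rintro h _ ⟨v, hv, rfl⟩
        exact ⟨φ v, h v hv, (hE φ v).symm⟩
    rw [hrange, hcomm, hU]
    constructor
    · rintro ⟨r, rfl⟩
      refine ⟨?_, fun v hv => ⟨fun i j l hi hj => ?_, fun i hi => ?_⟩⟩
      · refine LinearMap.ext fun v => funext fun ⟨i, hi⟩ => ?_
        rw [Module.End.mul_apply, Module.End.mul_apply, hρ₀]
        rcases i with _ | i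
        · simp [shiftMap_zero]
        · rw [shiftMap_succ, shiftMap_succ, hρ₀]
      · rw [hρ₀, hρ₀, hv.1 i j l hi hj, mul_assoc]
      · rw [hρ₀, hv.2 i hi, mul_zero]
    · rintro ⟨hT, hUφ⟩
      obtain ⟨r, hr⟩ := exists_eq_mul_of_commute_shiftMap hN b b.span_eq φ hT hUφ
      exact ⟨r, LinearMap.ext fun v => funext fun i => (hr v i).symm⟩

end LinearAlgebra

namespace SubmodulePair

/-! ### Coordinates in `J₀`, and tests for membership in `I₀` and `I₁` -/

section Coordinates

variable {Λ : Type u} [CommRing Λ] {t : Λ}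

/-- The element `a x + b y + c z` of `J₀`. -/
def coord (t a b c : Λ) : J₀ t :=
  (Ideal.Quotient.mk _ a, Ideal.Quotient.mk _ b, Ideal.Quotient.mk _ c)

theorem coord_surjective (ξ : J₀ t) : ∃ a b c, coord t a b c = ξ := by
  obtain ⟨α, β, γ⟩ := ξ
  obtain ⟨a, rfl⟩ := Ideal.Quotient.mk_surjective α
  obtain ⟨b, rfl⟩ := Ideal.Quotient.mk_surjective β
  obtain ⟨c, rfl⟩ := Ideal.Quotient.mk_surjective γ
  exact ⟨a, b, c, rfl⟩

theorem smul_coord (s a b c : Λ) : s • coord t a b c = coord t (s * a) (s * b) (s * c) := rfl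

theorem coord_add (a b c a' b' c' : Λ) :
    coord t a b c + coord t a' b' c' = coord t (a + a') (b + b') (c + c') := rfl

theorem coord_eq_iff {a b c a' b' c' : Λ} : coord t a b c = coord t a' b' c' ↔
    t ^ 7 ∣ a - a' ∧ t ^ 4 ∣ b - b' ∧ t ^ 2 ∣ c - c' := by
  simp [coord, Prod.ext_iff, Ideal.Quotient.eq, Ideal.mem_span_singleton]

theorem coord_eq_zero_iff {a b c : Λ} : coord t a b c = 0 ↔
    t ^ 7 ∣ a ∧ t ^ 4 ∣ b ∧ t ^ 2 ∣ c := by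
  simp [coord, Prod.ext_iff, Ideal.Quotient.eq_zero_iff_mem, Ideal.mem_span_singleton]

theorem mem_J₁_iff {ξ : J₀ t} : ξ ∈ J₁ t ↔
    ∃ p q : Λ, coord t (t ^ 3 * p) (t * (q - p)) (-q) = ξ := by
  have key : ∀ p q : Λ, p • (t ^ 3 • genX t - t • genY t) + q • (t • genY t - genZ t) =
      coord t (t ^ 3 * p) (t * (q - p)) (-q) := by
    intro p q
    have hx : genX t = coord t 1 0 0 := by simp [coord, genX]
    have hy : genY t = coord t 0 1 0 := by simp [coord, genY]
    have hz : genZ t = coord t 0 0 1 := by simp [coord, genZ]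
    rw [sub_eq_add_neg, sub_eq_add_neg, ← neg_one_smul Λ, ← neg_one_smul Λ (genZ t), hx, hy, hz]
    simp only [smul_coord, coord_add]
    congr 1 <;> ring
  simp only [J₁, Submodule.mem_span_pair, key]

theorem pow_four_smul_eq_zero_of_mem_J₁ {ξ : J₀ t} (hξ : ξ ∈ J₁ t) : t ^ 4 • ξ = 0 := by
  obtain ⟨p, q, rfl⟩ := mem_J₁_iff.1 hξ
  rw [smul_coord, coord_eq_zero_iff]
  exact ⟨⟨p, by ring⟩, ⟨t * (q - p), by ring⟩, ⟨-t ^ 2 * q, by ring⟩⟩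

theorem smul_eq_zero_of_mem_I₀ {ξ : J₀ t} (hξ : ξ ∈ I₀ t) : t ^ 6 • ξ = 0 := by
  refine (Submodule.span_le (p := LinearMap.ker (LinearMap.lsmul Λ (J₀ t) (t ^ 6)))).2 ?_ hξ
  rintro _ (rfl | rfl | rfl)
  · change t ^ 6 • t • coord t 1 0 0 = 0
    rw [smul_coord, smul_coord, coord_eq_zero_iff]
    exact ⟨⟨1, by ring⟩, by simp, by simp⟩
  · change t ^ 6 • coord t 0 1 0 = 0
    rw [smul_coord, coord_eq_zero_iff]
    exact ⟨by simp, ⟨t ^ 2, by ring⟩, by simp⟩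
  · change t ^ 6 • coord t 0 0 1 = 0
    rw [smul_coord, coord_eq_zero_iff]
    exact ⟨by simp, by simp, ⟨t ^ 4, by ring⟩⟩

theorem pow_three_smul_eq_zero_of_mem_I₁ {ξ : J₀ t} (hξ : ξ ∈ I₁ t) : t ^ 3 • ξ = 0 := by
  obtain ⟨η, hη, rfl⟩ := (Submodule.mem_smul_pointwise_iff_exists _ _ _).1 hξ
  rw [smul_smul, ← pow_succ, pow_four_smul_eq_zero_of_mem_J₁ hη]

variable [IsLocalRing Λ]

theorem mem_I₀_of_smul_eq_zero (ht : Ideal.span {t} = IsLocalRing.maximalIdeal Λ)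
    (h6 : t ^ 6 ≠ 0) {ξ : J₀ t} (hξ : t ^ 6 • ξ = 0) : ξ ∈ I₀ t := by
  obtain ⟨a, b, c, rfl⟩ := coord_surjective ξ
  rw [smul_coord, coord_eq_zero_iff] at hξ
  obtain ⟨d, hd⟩ := pow_dvd_of_pow_add_dvd (i := 6) (r := 1) ht h6 le_rfl hξ.1
  have : coord t a b c = d • t • genX t + b • genY t + c • genZ t := by
    have hx : genX t = coord t 1 0 0 := by simp [coord, genX]
    have hy : genY t = coord t 0 1 0 := by simp [coord, genY]
    have hz : genZ t = coord t 0 0 1 := by simp [coord, genZ]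
    rw [hx, hy, hz, hd]
    simp only [smul_coord, coord_add]
    congr 1 <;> ring
  rw [this]
  refine add_mem (add_mem ?_ ?_) ?_ <;>
    exact Submodule.smul_mem _ _ (Submodule.subset_span (by simp))

/-- In the parameters `p`, `q` of `mem_J₁_iff`, the two conditions say that `t` divides `p` and `q -
p`. So `t` divides both parameters and can be pulled out of `ξ`. The two tests are thus the
coordinates on `J₁/I₁`. -/
theorem mem_I₁_of_smul_eq_zero (ht : Ideal.span {t} = IsLocalRing.maximalIdeal Λ)
    (h6 : t ^ 6 ≠ 0) {ξ : J₀ t} (hξ : ξ ∈ J₁ t) (hx : t ^ 3 • ξ = 0) (hy : (t ^ 2 • ξ).2.1 = 0) :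
    ξ ∈ I₁ t := by
  obtain ⟨p, q, rfl⟩ := mem_J₁_iff.1 hξ
  rw [smul_coord, coord_eq_zero_iff] at hx
  rw [smul_coord, coord, Ideal.Quotient.eq_zero_iff_mem, Ideal.mem_span_singleton] at hy
  obtain ⟨p', rfl⟩ := pow_dvd_of_pow_add_dvd (i := 6) (r := 1) (c := p) ht h6 le_rfl
    (by convert hx.1 using 1; ring)
  obtain ⟨d, hd⟩ := pow_dvd_of_pow_add_dvd (i := 3) (r := 1) (c := q - t ^ 1 * p') ht h6
    (by omega) (by convert hy using 1; ring)
  obtain rfl : q = t * (d + p') := by linear_combination hd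
  refine (Submodule.mem_smul_pointwise_iff_exists _ _ _).2
    ⟨coord t (t ^ 3 * p') (t * ((d + p') - p')) (-(d + p')), mem_J₁_iff.2 ⟨_, _, rfl⟩, ?_⟩
  rw [smul_coord]
  congr 1 <;> ring

/-- The image of `k` in `J₀`: the residue class of `a` goes to `t⁶ a x`. -/
noncomputable def socleX (ht : Ideal.span {t} = IsLocalRing.maximalIdeal Λ) :
    IsLocalRing.ResidueField Λ →ₗ[Λ] J₀ t :=
  LinearMap.inl _ _ _ ∘ₗ socleMap ht 6 7 le_rfl

theorem socleX_residue (ht : Ideal.span {t} = IsLocalRing.maximalIdeal Λ) (a : Λ) :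
    socleX ht (IsLocalRing.residue Λ a) = coord t (t ^ 6 * a) 0 0 := by
  simp [socleX, socleMap_residue, coord, Prod.ext_iff]

theorem socleX_injective (ht : Ideal.span {t} = IsLocalRing.maximalIdeal Λ) (h6 : t ^ 6 ≠ 0) :
    Function.Injective (socleX ht) :=
  LinearMap.inl_injective.comp (socleMap_injective ht h6 rfl le_rfl)

/-- The residue class of `a` goes to `t³ a`, the coefficient of `y`. -/
abbrev socleY (ht : Ideal.span {t} = IsLocalRing.maximalIdeal Λ) :
    IsLocalRing.ResidueField Λ →ₗ[Λ] Λ ⧸ Ideal.span {t ^ 4} :=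
  socleMap ht 3 4 le_rfl

theorem socleY_injective (ht : Ideal.span {t} = IsLocalRing.maximalIdeal Λ) (h6 : t ^ 6 ≠ 0) :
    Function.Injective (socleY ht) :=
  socleMap_injective ht h6 rfl (by omega)

end Coordinates

/-! ### The object built from `T` and `U`, and the action of its endomorphisms on `kᵐ` -/

section Realization

variable {Λ : Type u} [CommRing Λ] [IsLocalRing Λ] {t : Λ}
  (ht : Ideal.span {t} = IsLocalRing.maximalIdeal Λ) {m : ℕ}
  (T : Module.End (IsLocalRing.ResidueField Λ) (Fin m → IsLocalRing.ResidueField Λ))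
  (U : Submodule (IsLocalRing.ResidueField Λ) (Fin m → IsLocalRing.ResidueField Λ))

/-- The submodule of `J₀ᵐ` of all `ξ` such that `t⁶ ξ` comes from `U`. -/
def ambientOf : Submodule Λ (Fin m → J₀ t) where
  carrier := {ξ | ∃ u ∈ U, ∀ i, socleX ht (u i) = t ^ 6 • ξ i}
  add_mem' := by
    rintro ξ η ⟨u, hu, h⟩ ⟨v, hv, h'⟩
    exact ⟨u + v, add_mem hu hv, fun i => by
      rw [Pi.add_apply, Pi.add_apply, map_add, smul_add, h, h']⟩
  zero_mem' := ⟨0, zero_mem _, fun i => by simp⟩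
  smul_mem' := by
    rintro c ξ ⟨u, hu, h⟩
    exact ⟨c • u, (U.restrictScalars Λ).smul_mem c hu, fun i => by
      rw [Pi.smul_apply, Pi.smul_apply, map_smul, h, smul_comm]⟩

/-- The submodule of `J₁ᵐ` determined by the graph of `T`. -/
def distinguishedOf : Submodule Λ (Fin m → J₀ t) where
  carrier := {ξ | (∀ i, ξ i ∈ J₁ t) ∧ ∃ p, (∀ i, socleX ht (p i) = t ^ 3 • ξ i) ∧
    ∀ i, socleY ht (T p i) = (t ^ 2 • ξ i).2.1}
  add_mem' := by
    rintro ξ η ⟨hξ, u, h, hy⟩ ⟨hη, v, h', hy'⟩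
    refine ⟨fun i => add_mem (hξ i) (hη i), u + v, fun i => ?_, fun i => ?_⟩
    · rw [Pi.add_apply, Pi.add_apply, map_add, smul_add, h, h']
    · rw [map_add, Pi.add_apply, Pi.add_apply, map_add, smul_add, hy, hy']
      rfl
  zero_mem' := ⟨fun i => zero_mem _, 0, fun i => by simp, fun i => by simp⟩
  smul_mem' := by
    rintro c ξ ⟨hξ, u, h, hy⟩
    refine ⟨fun i => Submodule.smul_mem _ _ (hξ i), c • u, fun i => ?_, fun i => ?_⟩
    · rw [Pi.smul_apply, Pi.smul_apply, map_smul, h, smul_comm]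
    · rw [T.map_smul_of_tower, Pi.smul_apply, Pi.smul_apply, map_smul, smul_comm, hy]
      rfl

variable {U} in
theorem mem_ambientOf_of_smul_eq_zero {ξ : Fin m → J₀ t} (h : ∀ i, t ^ 6 • ξ i = 0) :
    ξ ∈ ambientOf ht U :=
  ⟨0, zero_mem _, fun i => by simp [h]⟩

/-- The embedding of `kᵐ` into the socle of `ambientOf ht U`. -/
noncomputable def socleVec :
    (Fin m → IsLocalRing.ResidueField Λ) →ₗ[Λ] ambientOf ht U :=
  LinearMap.codRestrict (ambientOf ht U)
    (LinearMap.pi fun i => socleX ht ∘ₗ LinearMap.proj i) fun v =>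
      mem_ambientOf_of_smul_eq_zero ht fun i => by
        obtain ⟨a, ha⟩ := IsLocalRing.residue_surjective (v i)
        rw [LinearMap.pi_apply, LinearMap.comp_apply, LinearMap.proj_apply, ← ha, socleX_residue,
          smul_coord, coord_eq_zero_iff]
        exact ⟨⟨t ^ 5 * a, by ring⟩, by simp, by simp⟩

theorem socleVec_apply (v : Fin m → IsLocalRing.ResidueField Λ) (i : Fin m) :
    (socleVec ht U v).1 i = socleX ht (v i) :=
  rfl

theorem socleVec_injective (h6 : t ^ 6 ≠ 0) : Function.Injective (socleVec ht U) :=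
  fun _ _ h => funext fun i =>
    socleX_injective ht h6 (congrFun (congrArg Subtype.val h) i)

/-- The endomorphism `f` of `ambientOf ht U` induces `φ` on `kᵐ`. -/
def Induces (f : ambientOf ht U →ₗ[Λ] ambientOf ht U)
    (φ : Module.End (IsLocalRing.ResidueField Λ) (Fin m → IsLocalRing.ResidueField Λ)) : Prop :=
  ∀ v, f (socleVec ht U v) = socleVec ht U (φ v)

/-- The element `t a x + b y + c z` of `ambientOf ht U`. -/
def coordVec (a b c : Fin m → Λ) : ambientOf ht U :=
  ⟨fun i => coord t (t * a i) (b i) (c i), mem_ambientOf_of_smul_eq_zero ht fun i => by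
    rw [smul_coord, coord_eq_zero_iff]
    exact ⟨⟨a i, by ring⟩, ⟨t ^ 2 * b i, by ring⟩, ⟨t ^ 4 * c i, by ring⟩⟩⟩

theorem coordVec_apply (a b c : Fin m → Λ) (i : Fin m) :
    (coordVec ht U a b c).1 i = coord t (t * a i) (b i) (c i) :=
  rfl

theorem smul_coordVec (s : Λ) (a b c : Fin m → Λ) :
    s • coordVec ht U a b c = coordVec ht U (s • a) (s • b) (s • c) := by
  refine Subtype.ext (funext fun i => ?_)
  change s • coord t (t * a i) (b i) (c i) = coord t (t * (s * a i)) (s * b i) (s * c i)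
  rw [smul_coord, mul_left_comm]

theorem coordVec_add (a b c a' b' c' : Fin m → Λ) :
    coordVec ht U a b c + coordVec ht U a' b' c' = coordVec ht U (a + a') (b + b') (c + c') := by
  refine Subtype.ext (funext fun i => ?_)
  change coord t (t * a i) (b i) (c i) + coord t (t * a' i) (b' i) (c' i) =
    coord t (t * (a i + a' i)) (b i + b' i) (c i + c' i)
  rw [coord_add, mul_add]

theorem socleVec_eq_smul_coordVec (a : Fin m → Λ) :
    socleVec ht U (fun i => IsLocalRing.residue Λ (a i)) = t ^ 5 • coordVec ht U a 0 0 := by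
  refine Subtype.ext (funext fun i => ?_)
  rw [socleVec_apply, socleX_residue, smul_coordVec, coordVec_apply]
  congr 1
  · simp only [Pi.smul_apply, smul_eq_mul]; ring
  · simp
  · simp

variable {U} in
/-- A multiple of `t⁴` has no `y`-coordinate. -/
theorem pow_four_smul_snd_fst (ξ : ambientOf ht U) (i : Fin m) :
    ((t ^ 4 • ξ).1 i).2.1 = 0 := by
  obtain ⟨a, b, c, h⟩ := coord_surjective (ξ.1 i)
  change (t ^ 4 • ξ.1 i).2.1 = 0
  rw [← h, smul_coord, coord, Ideal.Quotient.eq_zero_iff_mem, Ideal.mem_span_singleton]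
  exact Dvd.intro _ rfl

/-- The socle vectors `t⁶ax` are exactly the elements of `t⁵M₀` killed by `t`: each is `t⁵ · tax`,
and conversely `t⁵` kills `y` and `z` while `t⁶ξ = 0` makes the `x`-coefficient of `ξ` divisible by
`t`. Linear maps respect this description. -/
theorem exists_induces (h6 : t ^ 6 ≠ 0) (f : ambientOf ht U →ₗ[Λ] ambientOf ht U) :
    ∃ φ, Induces ht U f φ := by
  have key : ∀ v, ∃ w, f (socleVec ht U v) = socleVec ht U w := by
    intro v
    choose a ha using fun i => IsLocalRing.residue_surjective (v i)
    obtain rfl : (fun i => IsLocalRing.residue Λ (a i)) = v := funext ha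
    have h0 : t ^ 6 • f (coordVec ht U a 0 0) = 0 := by
      rw [show t ^ 6 = t * t ^ 5 by ring, mul_smul, ← map_smul, ← socleVec_eq_smul_coordVec,
        ← map_smul, ← map_smul]
      convert map_zero f
      convert map_zero (socleVec ht U)
      funext i
      rw [Pi.smul_apply, Algebra.smul_def]
      change IsLocalRing.residue Λ t * _ = 0
      rw [(residue_eq_zero_iff_dvd ht).2 dvd_rfl, zero_mul]
    have h1 : ∀ i, ∃ d, (t ^ 5 • f (coordVec ht U a 0 0)).1 i =
        socleX ht (IsLocalRing.residue Λ d) := by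
      intro i
      obtain ⟨α, β, γ, h⟩ := coord_surjective ((f (coordVec ht U a 0 0)).1 i)
      have h2 : t ^ 6 • (f (coordVec ht U a 0 0)).1 i = 0 :=
        congrFun (congrArg Subtype.val h0) i
      rw [← h, smul_coord, coord_eq_zero_iff] at h2
      obtain ⟨d, hd⟩ := pow_dvd_of_pow_add_dvd (i := 6) (r := 1) ht h6 le_rfl h2.1
      refine ⟨d, ?_⟩
      change t ^ 5 • (f (coordVec ht U a 0 0)).1 i = _
      rw [← h, socleX_residue, smul_coord, coord_eq_iff, hd]
      exact ⟨⟨0, by ring⟩, ⟨t * β, by ring⟩, ⟨t ^ 3 * γ, by ring⟩⟩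
    choose d hd using h1
    refine ⟨fun i => IsLocalRing.residue Λ (d i), Subtype.ext (funext fun i => ?_)⟩
    rw [socleVec_eq_smul_coordVec, map_smul, hd, socleVec_apply]
  choose φ hφ using key
  refine ⟨{ toFun := φ, map_add' := fun v w => ?_, map_smul' := fun c v => ?_ }, hφ⟩
  · apply socleVec_injective ht U h6
    rw [← hφ, map_add, map_add, map_add, hφ, hφ]
  · obtain ⟨c, rfl⟩ := IsLocalRing.residue_surjective c
    apply socleVec_injective ht U h6
    change socleVec ht U (φ (c • v)) = socleVec ht U (c • φ v)
    rw [← hφ, map_smul, map_smul, map_smul, hφ]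

variable {ht U} {f : ambientOf ht U →ₗ[Λ] ambientOf ht U}
  {φ : Module.End (IsLocalRing.ResidueField Λ) (Fin m → IsLocalRing.ResidueField Λ)}

/-- Transports `φ` to both layers: `s = t⁶` reads off `U`, and `s = t³` reads off the first
component of the graph of `T`. -/
theorem Induces.smul_apply (hφ : Induces ht U f φ) {s : Λ} {ξ : ambientOf ht U}
    {u : Fin m → IsLocalRing.ResidueField Λ} (hu : ∀ i, socleX ht (u i) = s • ξ.1 i) (i : Fin m) :
    socleX ht (φ u i) = s • (f ξ).1 i := by
  have h : socleVec ht U u = s • ξ := Subtype.ext (funext hu)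
  rw [← socleVec_apply ht U, ← hφ, h, map_smul]
  rfl

theorem Induces.mem (h6 : t ^ 6 ≠ 0) (hφ : Induces ht U f φ)
    {u : Fin m → IsLocalRing.ResidueField Λ} (hu : u ∈ U) : φ u ∈ U := by
  choose a ha using fun i => IsLocalRing.residue_surjective (u i)
  let ξ : ambientOf ht U := ⟨fun i => coord t (a i) 0 0, u, hu, fun i => by
    rw [← ha, socleX_residue, smul_coord, mul_zero]⟩
  obtain ⟨u', hu', h⟩ := (f ξ).2
  have : φ u = u' := funext fun i => socleX_injective ht h6 <| by
    rw [h, hφ.smul_apply (s := t ^ 6) (ξ := ξ)]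
    intro i
    rw [← ha, socleX_residue, smul_coord, mul_zero]
  rwa [this]

/-- A morphism acts in the same way on the socle layers of `x` and `y`. -/
theorem Induces.socleY_apply (h6 : t ^ 6 ≠ 0) (hφ : Induces ht U f φ)
    (hf : ∀ ξ : ambientOf ht U, ξ.1 ∈ distinguishedOf ht T → (f ξ).1 ∈ distinguishedOf ht T)
    (a : Fin m → Λ) (i : Fin m) :
    ((f (coordVec ht U 0 (t ^ 3 • a) 0)).1 i).2.1 =
      socleY ht (φ (fun i => IsLocalRing.residue Λ (a i)) i) := by
  -- This is `ta(t³x - ty)`, an element of `I₁ᵐ`. It links the two layers: its `x`-part leads to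
  -- `t⁶ax`, its `y`-part to `t³ay`.
  set ζ : ambientOf ht U := coordVec ht U (t ^ 3 • a) (-(t ^ 2 • a)) 0 with hζ
  have hζmem : ζ.1 ∈ distinguishedOf ht T := by
    refine ⟨fun i => mem_J₁_iff.2 ⟨t * a i, 0, ?_⟩, 0, fun i => ?_, fun i => ?_⟩
    · rw [hζ, coordVec_apply]
      simp only [Pi.smul_apply, Pi.neg_apply, smul_eq_mul, Pi.zero_apply, neg_zero]
      congr 1 <;> ring
    · rw [hζ, coordVec_apply, smul_coord, Pi.zero_apply, map_zero, eq_comm, coord_eq_zero_iff]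
      simp only [Pi.smul_apply, Pi.neg_apply, smul_eq_mul, Pi.zero_apply]
      exact ⟨⟨a i, by ring⟩, ⟨-(t * a i), by ring⟩, by simp⟩
    · rw [hζ, coordVec_apply, smul_coord, map_zero, Pi.zero_apply, map_zero, eq_comm, coord,
        Ideal.Quotient.eq_zero_iff_mem, Ideal.mem_span_singleton]
      exact ⟨-a i, by simp only [Pi.smul_apply, Pi.neg_apply, smul_eq_mul]; ring⟩
  obtain ⟨p, q, hpq⟩ := mem_J₁_iff.1 ((hf ζ hζmem).1 i)
  obtain ⟨d, hd⟩ := IsLocalRing.residue_surjective (φ (fun i => IsLocalRing.residue Λ (a i)) i)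
  -- Since `ζ` is divisible by `t²` in the ambient module and `t²z = 0`, the `z`-coordinate `-q` of
  -- its image vanishes. This is the role of the summand generated by `z`.
  have hq : t ^ 2 ∣ q := by
    have h1 : ζ = t ^ 2 • coordVec ht U (t • a) (-a) 0 := by
      rw [hζ, smul_coordVec, smul_smul, ← pow_succ, smul_neg, smul_zero]
    have h2 : (f ζ).1 i = t ^ 2 • (f (coordVec ht U (t • a) (-a) 0)).1 i := by
      rw [h1, map_smul]; rfl
    obtain ⟨α, β, γ, h⟩ := coord_surjective ((f (coordVec ht U (t • a) (-a) 0)).1 i)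
    rw [h2, ← h, smul_coord, coord_eq_iff] at hpq
    have := dvd_add hpq.2.2 (Dvd.intro γ rfl)
    simpa using this
  -- From `t²ζ = t⁶ax`, on which `f` is known to act by `φ`.
  have hp : t ^ 2 ∣ p - t * d := by
    have h1 : t ^ 2 • ζ = socleVec ht U (fun i => IsLocalRing.residue Λ (a i)) := by
      rw [socleVec_eq_smul_coordVec, hζ, smul_coordVec, smul_coordVec]
      refine Subtype.ext (funext fun i => ?_)
      rw [coordVec_apply, coordVec_apply, coord_eq_iff]
      simp only [Pi.smul_apply, Pi.neg_apply, smul_eq_mul, Pi.zero_apply]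
      exact ⟨⟨0, by ring⟩, ⟨-a i, by ring⟩, by simp⟩
    have h2 : t ^ 2 • (f ζ).1 i = socleX ht (IsLocalRing.residue Λ d) := by
      rw [hd, ← socleVec_apply ht U, ← hφ, ← h1, map_smul]; rfl
    rw [← hpq, smul_coord, socleX_residue, coord_eq_iff] at h2
    refine pow_dvd_of_pow_add_dvd (i := 5) ht h6 le_rfl ?_
    convert h2.1 using 1
    ring
  -- The first summand has image in `t⁴M₀`, so it contributes nothing to the `y`-coordinate; only
  -- `-tζ` matters, giving `t²(p - q) ≡ t³d` modulo `t⁴`.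
  have hsum : coordVec ht U 0 (t ^ 3 • a) 0 =
      t ^ 4 • coordVec ht U a 0 0 + (-t) • ζ := by
    rw [hζ, smul_coordVec, smul_coordVec, coordVec_add]
    congr 1
    · rw [smul_smul]; module
    · rw [smul_zero]; module
    · simp
  rw [hsum, map_add, map_smul, map_smul]
  change ((t ^ 4 • f (coordVec ht U a 0 0)).1 i).2.1 + ((-t) • (f ζ).1 i).2.1 = _
  rw [pow_four_smul_snd_fst, zero_add, ← hpq, smul_coord, ← hd, socleMap_residue, coord,
    Ideal.Quotient.eq, Ideal.mem_span_singleton]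
  obtain ⟨q', rfl⟩ := hq
  obtain ⟨p', hp'⟩ := hp
  exact ⟨p' - q', by linear_combination t ^ 2 * hp'⟩

/-- The element `t³ a x + t b y - (a + b) z` of the distinguished submodule, when `T` maps the
residue class of `a` to that of `b`. -/
theorem coordVec_mem_distinguishedOf {a b : Fin m → Λ}
    (hab : ∀ i, T (fun i => IsLocalRing.residue Λ (a i)) i = IsLocalRing.residue Λ (b i)) :
    (coordVec ht U (t ^ 2 • a) (t • b) (-(a + b))).1 ∈ distinguishedOf ht T := by
  refine ⟨fun i => mem_J₁_iff.2 ⟨a i, a i + b i, ?_⟩, fun i => IsLocalRing.residue Λ (a i),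
    fun i => ?_, fun i => ?_⟩
  · rw [coordVec_apply]
    simp only [Pi.smul_apply, Pi.neg_apply, smul_eq_mul, Pi.add_apply]
    congr 1 <;> ring
  · rw [coordVec_apply, smul_coord, socleX_residue, coord_eq_iff]
    simp only [Pi.smul_apply, Pi.neg_apply, smul_eq_mul, Pi.add_apply]
    exact ⟨⟨0, by ring⟩, ⟨-b i, by ring⟩, ⟨t * (a i + b i), by ring⟩⟩
  · rw [hab, coordVec_apply, smul_coord, socleMap_residue, coord]
    congr 1
    simp only [Pi.smul_apply, smul_eq_mul]
    ring

theorem smul_coordVec_of_distinguished {a b : Fin m → Λ} (i : Fin m) :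
    socleX ht (IsLocalRing.residue Λ (a i)) =
      t ^ 3 • (coordVec ht U (t ^ 2 • a) (t • b) (-(a + b))).1 i := by
  rw [coordVec_apply, smul_coord, socleX_residue, coord_eq_iff]
  simp only [Pi.smul_apply, Pi.neg_apply, smul_eq_mul, Pi.add_apply]
  exact ⟨⟨0, by ring⟩, ⟨-b i, by ring⟩, ⟨t * (a i + b i), by ring⟩⟩

/-- The image of a distinguished vector with graph point `(a, Ta)` has graph point `(φa, φTa)`: the
first entry is read on the `x`-layer, the second on the `y`-layer by `Induces.socleY_apply`. Lying
on the graph of `T` then means `Tφa = φTa`. -/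
theorem Induces.commute (h6 : t ^ 6 ≠ 0) (hφ : Induces ht U f φ)
    (hf : ∀ ξ : ambientOf ht U, ξ.1 ∈ distinguishedOf ht T → (f ξ).1 ∈ distinguishedOf ht T) :
    Commute φ T := by
  refine LinearMap.ext fun v => ?_
  choose a ha using fun i => IsLocalRing.residue_surjective (v i)
  obtain rfl : (fun i => IsLocalRing.residue Λ (a i)) = v := funext ha
  choose b hb using fun i =>
    IsLocalRing.residue_surjective (T (fun i => IsLocalRing.residue Λ (a i)) i)
  set ξ := coordVec ht U (t ^ 2 • a) (t • b) (-(a + b)) with hξ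
  have hmem : ξ.1 ∈ distinguishedOf ht T :=
    coordVec_mem_distinguishedOf T fun i => (hb i).symm
  obtain ⟨-, p, hp, hTp⟩ := hf ξ hmem
  obtain rfl : φ (fun i => IsLocalRing.residue Λ (a i)) = p := funext fun i =>
    socleX_injective ht h6 <| by
      rw [hp, hφ.smul_apply (s := t ^ 3) (ξ := ξ)]
      exact smul_coordVec_of_distinguished
  funext i
  apply socleY_injective ht h6
  rw [Module.End.mul_apply, Module.End.mul_apply, hTp]
  rw [show T (fun i => IsLocalRing.residue Λ (a i)) = fun i => IsLocalRing.residue Λ (b i) from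
    (funext hb).symm, ← hφ.socleY_apply T h6 hf]
  have hsum : t ^ 2 • ξ = t ^ 4 • coordVec ht U a 0 0 + coordVec ht U 0 (t ^ 3 • b) 0 := by
    rw [hξ, smul_coordVec, smul_coordVec, coordVec_add]
    refine Subtype.ext (funext fun i => ?_)
    rw [coordVec_apply, coordVec_apply, coord_eq_iff]
    simp only [Pi.smul_apply, Pi.neg_apply, smul_eq_mul, Pi.add_apply, Pi.zero_apply]
    exact ⟨⟨0, by ring⟩, ⟨0, by ring⟩, ⟨-(a i + b i), by ring⟩⟩
  have : t ^ 2 • (f ξ).1 i = (t ^ 4 • f (coordVec ht U a 0 0)).1 i +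
      (f (coordVec ht U 0 (t ^ 3 • b) 0)).1 i := by
    rw [← map_smul, ← Pi.add_apply, ← Submodule.coe_add, ← map_add, ← hsum, map_smul]
    rfl
  rw [this, Prod.snd_add, Prod.fst_add, pow_four_smul_snd_fst, zero_add]

variable (φ) in
/-- An endomorphism of `kᵐ` that commutes with `T` and preserves `U` is induced by a morphism. -/
theorem exists_isHom_induces (hT : Commute φ T) (hU : ∀ u ∈ U, φ u ∈ U) :
    ∃ f : ambientOf ht U →ₗ[Λ] ambientOf ht U,
      (∀ ξ : ambientOf ht U, ξ.1 ∈ distinguishedOf ht T → (f ξ).1 ∈ distinguishedOf ht T) ∧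
      Induces ht U f φ := by
  -- Any lift of the matrix of `φ` works: it acts on `J₀ᵐ` by scalars from `Λ`, so it respects every
  -- submodule of `J₀` and both layers.
  choose A hA using fun i j : Fin m =>
    IsLocalRing.residue_surjective (LinearMap.toMatrix' φ i j)
  have hφ : ∀ v i, φ v i = ∑ j, A i j • v j := by
    intro v i
    rw [← LinearMap.toMatrix'_mulVec φ v]
    simp only [Matrix.mulVec, dotProduct, ← hA]
    rfl
  let F : (Fin m → J₀ t) →ₗ[Λ] (Fin m → J₀ t) :=
    LinearMap.pi fun i => ∑ j, A i j • LinearMap.proj j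
  have hF : ∀ ξ i, F ξ i = ∑ j, A i j • ξ j := fun ξ i => by simp [F]
  have hX : ∀ (s : Λ) (ξ : Fin m → J₀ t) (u : Fin m → IsLocalRing.ResidueField Λ),
      (∀ i, socleX ht (u i) = s • ξ i) → ∀ i, socleX ht (φ u i) = s • F ξ i := by
    intro s ξ u hu i
    rw [hφ, hF, map_sum, Finset.smul_sum]
    refine Finset.sum_congr rfl fun j _ => ?_
    rw [map_smul, hu, smul_comm]
  have hFU : ∀ ξ ∈ ambientOf ht U, F ξ ∈ ambientOf ht U := by
    rintro ξ ⟨u, hu, h⟩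
    exact ⟨φ u, hU u hu, hX _ _ _ h⟩
  refine ⟨F.restrict hFU, ?_, fun v => Subtype.ext (funext fun i => ?_)⟩
  · rintro ⟨ξ, hξ⟩ ⟨hJ, p, hp, hTp⟩
    refine ⟨fun i => ?_, φ p, hX _ _ _ hp, fun i => ?_⟩
    · change F ξ i ∈ J₁ t
      rw [hF]
      exact sum_mem fun j _ => Submodule.smul_mem _ _ (hJ j)
    · change _ = (t ^ 2 • F ξ i).2.1
      rw [← Module.End.mul_apply, ← hT.eq, Module.End.mul_apply, hφ, hF, map_sum,
        Finset.smul_sum, Prod.snd_sum, Prod.fst_sum]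
      refine Finset.sum_congr rfl fun j _ => ?_
      rw [map_smul, hTp, smul_comm (t ^ 2)]
      rfl
  · have := hX 1 (socleVec ht U v).1 v (fun i => by rw [one_smul, socleVec_apply]) i
    rw [one_smul] at this
    exact this.symm

end Realization

end SubmodulePair

namespace SubmodulePair

/-! ### Endomorphisms inducing zero are those factoring through copies of `I` -/

section ControlIdeal

variable {Λ : Type u} [CommRing Λ] [IsLocalRing Λ] {t : Λ}
  (ht : Ideal.span {t} = IsLocalRing.maximalIdeal Λ) {m : ℕ}
  (T : Module.End (IsLocalRing.ResidueField Λ) (Fin m → IsLocalRing.ResidueField Λ))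
  (U : Submodule (IsLocalRing.ResidueField Λ) (Fin m → IsLocalRing.ResidueField Λ))
  [IsNoetherianRing Λ]

/-- The object of `S(Λ)` attached to an endomorphism `T` of `kᵐ` and a subspace `U` of `kᵐ`. -/
def pairOf : SubmodulePair Λ where
  carrier := ambientOf ht U
  sub := (distinguishedOf ht T).submoduleOf (ambientOf ht U)

variable {ht T U} {f : ambientOf ht U →ₗ[Λ] ambientOf ht U}

/-- Every socle vector is `t³ξ` with `ξ` in `M₁`. A morphism to copies of `I` sends `ξ` to a tuple
in `I₁`, which is annihilated by `t³`. -/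
theorem induces_zero_of_factorsThroughCopies
    (hf : FactorsThroughCopies (controlObject t) (pairOf ht T U) f) : Induces ht U f 0 := by
  obtain ⟨r, g, h, hg, hh, rfl⟩ := hf
  intro v
  choose a ha using fun i => IsLocalRing.residue_surjective (v i)
  obtain rfl : (fun i => IsLocalRing.residue Λ (a i)) = v := funext ha
  choose b hb using fun i =>
    IsLocalRing.residue_surjective (T (fun i => IsLocalRing.residue Λ (a i)) i)
  let ξ : (pairOf ht T U).carrier := coordVec ht U (t ^ 2 • a) (t • b) (-(a + b))
  have hmem : ξ ∈ (pairOf ht T U).sub := coordVec_mem_distinguishedOf (U := U) T fun i => (hb i).symm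
  have hξ : socleVec ht U (fun i => IsLocalRing.residue Λ (a i)) = t ^ 3 • ξ :=
    Subtype.ext (funext fun i => smul_coordVec_of_distinguished i)
  have hzero : t ^ 3 • g ξ = 0 := by
    funext j
    exact Subtype.ext (pow_three_smul_eq_zero_of_mem_I₁ (hg ξ hmem j (Set.mem_univ j)))
  rw [hξ, LinearMap.zero_apply, map_zero]
  change h (g (t ^ 3 • ξ)) = 0
  rw [map_smul, hzero, map_zero]

/-- If `φ = 0`, the tests for `I₀` and `I₁` show that `f` lands in the subobject `Iᵐ` of `M`, so it
factors through the inclusion. -/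
theorem factorsThroughCopies_of_induces_zero (h6 : t ^ 6 ≠ 0) (h0 : Induces ht U f 0)
    (hf : IsHom (pairOf ht T U) (pairOf ht T U) f) :
    FactorsThroughCopies (controlObject t) (pairOf ht T U) f := by
  have hI₀ : ∀ ξ i, (f ξ).1 i ∈ I₀ t := fun ξ i => by
    obtain ⟨u, -, hu⟩ := ξ.2
    refine mem_I₀_of_smul_eq_zero ht h6 ?_
    rw [← h0.smul_apply hu, LinearMap.zero_apply, Pi.zero_apply, map_zero]
  let g : ambientOf ht U →ₗ[Λ] (Fin m → I₀ t) :=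
    LinearMap.pi fun i => LinearMap.codRestrict (I₀ t)
      (LinearMap.proj i ∘ₗ (ambientOf ht U).subtype ∘ₗ f) fun ξ => hI₀ ξ i
  let h : (Fin m → I₀ t) →ₗ[Λ] ambientOf ht U :=
    LinearMap.codRestrict (ambientOf ht U)
      (LinearMap.pi fun i => (I₀ t).subtype ∘ₗ LinearMap.proj i) fun η =>
        mem_ambientOf_of_smul_eq_zero ht fun i => smul_eq_zero_of_mem_I₀ (η i).2
  refine ⟨m, g, h, fun ξ hξ i _ => ?_, fun η hη => ?_, rfl⟩
  · obtain ⟨hJ, p, hp, hTp⟩ := hf ξ hξ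
    obtain ⟨-, p', hp', -⟩ := hξ
    -- The graph point of `f ξ` has first entry `φ p' = 0`, hence also second entry `T 0 = 0`.
    have hp0 : p = 0 := funext fun i => socleX_injective ht h6 <| by
      rw [hp]
      exact (h0.smul_apply hp' i).symm
    refine mem_I₁_of_smul_eq_zero ht h6 (hJ i) ?_ ?_
    · exact (hp i).symm.trans (by rw [hp0, Pi.zero_apply, map_zero])
    · exact (hTp i).symm.trans (by rw [hp0, map_zero, Pi.zero_apply, map_zero])
  · have hη' : ∀ i, (η i).1 ∈ I₁ t := fun i => hη i (Set.mem_univ i)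
    refine ⟨fun i => ?_, 0, fun i => ?_, fun i => ?_⟩
    · exact Submodule.smul_le_self_of_tower t (J₁ t) (hη' i)
    · rw [Pi.zero_apply, map_zero]
      exact (pow_three_smul_eq_zero_of_mem_I₁ (hη' i)).symm
    · obtain ⟨ζ, hζ, hζη⟩ := (Submodule.mem_smul_pointwise_iff_exists _ _ _).1 (hη' i)
      obtain ⟨p, q, rfl⟩ := mem_J₁_iff.1 hζ
      change _ = (t ^ 2 • (η i).1).2.1
      rw [← hζη, smul_coord, smul_coord, map_zero, Pi.zero_apply, map_zero, eq_comm, coord,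
        Ideal.Quotient.eq_zero_iff_mem, Ideal.mem_span_singleton]
      exact ⟨q - p, by ring⟩

end ControlIdeal

end SubmodulePair

/-! ### The isomorphism with `R` -/

open SubmodulePair in
theorem mainTheorem4 {Λ : Type u} [CommRing Λ] [IsLocalRing Λ]
    (huniserial : ∀ 𝔞 𝔟 : Ideal Λ, 𝔞 ≤ 𝔟 ∨ 𝔟 ≤ 𝔞)
    (n : ℕ) (hn : 7 ≤ n) (hlength : Module.length Λ Λ = n)
    (t : Λ) (ht : Ideal.span {t} = IsLocalRing.maximalIdeal Λ)
    (R : Type v) [Ring R] [Algebra (IsLocalRing.ResidueField Λ) R]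
    [FiniteDimensional (IsLocalRing.ResidueField Λ) R] :
    ∃ (M : SubmodulePair Λ)
      (e : (M.endAlg ⧸ M.endIdeal (SubmodulePair.controlObject t)) ≃+* R),
      ∀ (a : Λ) (f : M.endAlg),
        e (Ideal.Quotient.mk _ (a • f)) =
          IsLocalRing.residue Λ a • e (Ideal.Quotient.mk _ f) := by
  have h6 : t ^ 6 ≠ 0 := pow_ne_zero_of_lt_length ht (by rw [hlength]; exact_mod_cast hn)
  have hfin : IsFiniteLength Λ Λ := Module.length_ne_top_iff.1 (by simp [hlength])
  have : IsNoetherianRing Λ := (isFiniteLength_iff_isNoetherian_isArtinian.1 hfin).1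
  obtain ⟨m, T, U, ρ, hρ, hrange⟩ :=
    exists_algHom_range_eq_commute_preserve (IsLocalRing.ResidueField Λ) R
  have key : ∀ f : (pairOf ht T U).endAlg, ∃ r : R, Induces ht U f.1 (ρ r) := by
    intro f
    obtain ⟨φ, hφ⟩ := exists_induces ht U h6 f.1
    obtain ⟨r, rfl⟩ := (hrange φ).2 ⟨hφ.commute T h6 f.2, fun _ => hφ.mem h6⟩
    exact ⟨r, hφ⟩
  -- Uniqueness of the induced element of `R` yields all the homomorphism laws for the chosen
  -- function `F`.
  have huniq : ∀ (f : ambientOf ht U →ₗ[Λ] ambientOf ht U) (r s : R),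
      Induces ht U f (ρ r) → Induces ht U f (ρ s) → r = s := fun f r s hr hs =>
    hρ (LinearMap.ext fun v => socleVec_injective ht U h6 (by rw [← hr, hs]))
  choose F hF using key
  let Φ : (pairOf ht T U).endAlg →+* R :=
    { toFun := F
      map_one' := huniq _ _ _ (hF 1) fun v => by rw [map_one]; rfl
      map_mul' := fun f g => huniq _ _ _ (hF (f * g)) fun v => by
        rw [map_mul, Module.End.mul_apply, ← hF f, ← hF g]; rfl
      map_zero' := huniq _ _ _ (hF 0) fun v => by
        rw [map_zero, LinearMap.zero_apply, map_zero]; rfl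
      map_add' := fun f g => huniq _ _ _ (hF (f + g)) fun v => by
        rw [map_add, LinearMap.add_apply, map_add, ← hF f, ← hF g]; rfl }
  have hΦ : ∀ f, Induces ht U f.1 (ρ (Φ f)) := hF
  have hsmul : ∀ (a : Λ) f, Φ (a • f) = IsLocalRing.residue Λ a • Φ f := fun a f =>
    huniq _ _ _ (hΦ (a • f)) fun v => by
      rw [map_smul, LinearMap.smul_apply]
      change _ = socleVec ht U (a • _)
      rw [map_smul, ← hΦ f]
      rfl
  have hker : ∀ f, Φ f = 0 ↔
      f ∈ (pairOf ht T U).endIdeal (SubmodulePair.controlObject t) := by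
    intro f
    constructor
    · intro h
      have h0 := hΦ f
      rw [h, map_zero] at h0
      exact factorsThroughCopies_of_induces_zero h6 h0 f.2
    · intro h
      have h0 : Induces ht U f.1 0 := induces_zero_of_factorsThroughCopies h
      exact huniq _ _ _ (hΦ f) (by rwa [map_zero])
  have hsurj : Function.Surjective Φ := by
    intro r
    obtain ⟨hT, hU⟩ := (hrange (ρ r)).1 ⟨r, rfl⟩
    obtain ⟨f, hf, hfr⟩ := exists_isHom_induces (ht := ht) T (ρ r) hT hU
    exact ⟨⟨f, hf⟩, huniq _ _ _ (hΦ ⟨f, hf⟩) hfr⟩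
  let Ψ := Ideal.Quotient.lift ((pairOf ht T U).endIdeal (SubmodulePair.controlObject t)) Φ
    fun f hf => (hker f).2 hf
  refine ⟨pairOf ht T U, RingEquiv.ofBijective Ψ ⟨(injective_iff_map_eq_zero _).2 fun x hx => ?_,
    Ideal.Quotient.lift_surjective_of_surjective _ _ hsurj⟩, fun a f => hsmul a f⟩
  obtain ⟨f, rfl⟩ := Ideal.Quotient.mk_surjective x
  exact Ideal.Quotient.eq_zero_iff_mem.2 ((hker f).1 hx)
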